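/- Let $W, X, Y, Z$ be real Banach lattices such that $X$ and $Y$ have order continuous norms (that is, $\inf_{x\in D}\|x\|=0$ for every nonempty downwards directed set $D$ with $\inf D=0$) and $Z$ is Dedekind complete. For ordered vector spaces $E,F$ let $L^r(E,F)$ be the space of regular operators from $E$ to $F$, i.e. of differences of two positive linear operators, ordered by $S\le T$ iff $T-S$ is positive; the modulus $|T|$ of $T$ is the supremum of $T$ and $-T$ in $L^r(E,F)$, if it exists. For $A\in L^r(Y,Z)$ and $B\in L^r(W,X)$ let $M_{A,B}\in L^r\big(L^r(X,Y),L^r(W,Z)\big)$ be the two-sided multiplication operator $M_{A,B}(T)=ATB$. Then for all $A\in L^r(Y,Z)$ and all $B\in L^r(W,X)$ the moduli $|A|$, $|B|$ and $|M_{A,B}|$ exist, and $$|M_{A,B}|=M_{|A|,|B|}.$$ -/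

import Mathlib

/-- The norm of a Banach lattice is order continuous: the infimum of the norms over every
(nonempty) downwards directed set with infimum zero is zero. -/
def OrderContinuousNorm (E : Type*) [NormedAddCommGroup E] [Lattice E] : Prop :=
  ∀ D : Set E, D.Nonempty → DirectedOn (fun x y => y ≤ x) D → IsGLB D 0 →
    IsGLB ((fun x => ‖x‖) '' D) 0

/-- A linear operator between ordered vector spaces is positive if it maps positive vectors to
positive vectors. -/
def IsPositiveOp {E F : Type*} [AddCommGroup E] [PartialOrder E] [Module ℝ E]
    [AddCommGroup F] [PartialOrder F] [Module ℝ F] (T : E →ₗ[ℝ] F) : Prop :=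
  ∀ x : E, 0 ≤ x → 0 ≤ T x

section Basic

variable {E F G : Type*} [AddCommGroup E] [PartialOrder E] [Module ℝ E]
  [AddCommGroup F] [PartialOrder F] [Module ℝ F]
  [AddCommGroup G] [PartialOrder G] [Module ℝ G]

theorem IsPositiveOp.zero : IsPositiveOp (0 : E →ₗ[ℝ] F) := fun _ _ => le_rfl

theorem IsPositiveOp.add [IsOrderedAddMonoid F] {S T : E →ₗ[ℝ] F} (hS : IsPositiveOp S)
    (hT : IsPositiveOp T) : IsPositiveOp (S + T) :=
  fun x hx => add_nonneg (hS x hx) (hT x hx)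

theorem IsPositiveOp.smul [IsOrderedModule ℝ F] {c : ℝ} (hc : 0 ≤ c) {T : E →ₗ[ℝ] F}
    (hT : IsPositiveOp T) : IsPositiveOp (c • T) :=
  fun x hx => smul_nonneg hc (hT x hx)

theorem IsPositiveOp.comp {S : F →ₗ[ℝ] G} {T : E →ₗ[ℝ] F} (hS : IsPositiveOp S)
    (hT : IsPositiveOp T) : IsPositiveOp (S ∘ₗ T) :=
  fun x hx => hS _ (hT x hx)

end Basic

/-- The subspace of regular operators: differences of two positive linear operators. -/
def regularOperators (E F : Type*) [AddCommGroup E] [PartialOrder E] [Module ℝ E]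
    [AddCommGroup F] [PartialOrder F] [IsOrderedAddMonoid F] [Module ℝ F] [IsOrderedModule ℝ F] :
    Submodule ℝ (E →ₗ[ℝ] F) where
  carrier := {T | ∃ P Q : E →ₗ[ℝ] F, IsPositiveOp P ∧ IsPositiveOp Q ∧ T = P - Q}
  zero_mem' := ⟨0, 0, IsPositiveOp.zero, IsPositiveOp.zero, (sub_zero 0).symm⟩
  add_mem' := by
    rintro _ _ ⟨P, Q, hP, hQ, rfl⟩ ⟨P', Q', hP', hQ', rfl⟩
    exact ⟨P + P', Q + Q', hP.add hP', hQ.add hQ', by abel⟩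
  smul_mem' := by
    rintro c _ ⟨P, Q, hP, hQ, rfl⟩
    rcases le_total 0 c with hc | hc
    · exact ⟨c • P, c • Q, hP.smul hc, hQ.smul hc, smul_sub c P Q⟩
    · have hc' : 0 ≤ -c := neg_nonneg.mpr hc
      exact ⟨(-c) • Q, (-c) • P, hQ.smul hc', hP.smul hc', by module⟩

/-- The ordered vector space `L^r(E, F)` of regular operators from `E` to `F`. -/
def Lr (E F : Type*) [AddCommGroup E] [PartialOrder E] [Module ℝ E]
    [AddCommGroup F] [PartialOrder F] [IsOrderedAddMonoid F] [Module ℝ F] [IsOrderedModule ℝ F] :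
    Type _ :=
  ↥(regularOperators E F)

namespace Lr

section

variable {E F : Type*} [AddCommGroup E] [PartialOrder E] [Module ℝ E]
  [AddCommGroup F] [PartialOrder F] [IsOrderedAddMonoid F] [Module ℝ F] [IsOrderedModule ℝ F]

instance : AddCommGroup (Lr E F) := inferInstanceAs (AddCommGroup ↥(regularOperators E F))

instance : Module ℝ (Lr E F) := inferInstanceAs (Module ℝ ↥(regularOperators E F))

/-- The linear map underlying a regular operator. -/
def toLin : Lr E F →ₗ[ℝ] (E →ₗ[ℝ] F) := (regularOperators E F).subtype

theorem toLin_injective : Function.Injective (toLin : Lr E F →ₗ[ℝ] (E →ₗ[ℝ] F)) :=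
  (regularOperators E F).injective_subtype

theorem exists_pos_sub_pos (T : Lr E F) :
    ∃ P Q : E →ₗ[ℝ] F, IsPositiveOp P ∧ IsPositiveOp Q ∧ toLin T = P - Q :=
  T.2

/-- A difference of positive operators as an element of `L^r(E, F)`. -/
def mk (T : E →ₗ[ℝ] F)
    (hT : ∃ P Q : E →ₗ[ℝ] F, IsPositiveOp P ∧ IsPositiveOp Q ∧ T = P - Q) : Lr E F :=
  ⟨T, hT⟩

@[simp] theorem toLin_mk (T : E →ₗ[ℝ] F)
    (hT : ∃ P Q : E →ₗ[ℝ] F, IsPositiveOp P ∧ IsPositiveOp Q ∧ T = P - Q) :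
    toLin (mk T hT) = T := rfl

/-- The operator order: `S ≤ T` if and only if `T - S` is positive. The domain is assumed directed
(as every vector lattice is), so that operators are determined by their values on positive
vectors. -/
instance [IsOrderedAddMonoid E] [IsDirectedOrder E] : PartialOrder (Lr E F) where
  le S T := IsPositiveOp (toLin T - toLin S)
  le_refl S := by
    rw [sub_self]
    exact IsPositiveOp.zero
  le_trans S T U hST hTU := by
    have h := hST.add hTU
    rwa [sub_add_sub_comm, add_comm (toLin T), add_sub_add_right_eq_sub] at h
  le_antisymm S T hST hTS := by
    have key : ∀ x : E, 0 ≤ x → toLin S x = toLin T x := fun x hx =>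
      le_antisymm (sub_nonneg.mp (hST x hx)) (sub_nonneg.mp (hTS x hx))
    refine toLin_injective (LinearMap.ext fun x => ?_)
    obtain ⟨y, hxy, hy⟩ := exists_ge_ge x 0
    have h1 := key y hy
    have h2 := key (y - x) (sub_nonneg.mpr hxy)
    rw [map_sub, map_sub, h1] at h2
    exact sub_right_injective h2

theorem le_def [IsOrderedAddMonoid E] [IsDirectedOrder E] {S T : Lr E F} :
    S ≤ T ↔ IsPositiveOp (toLin T - toLin S) := Iff.rfl

theorem nonneg_iff [IsOrderedAddMonoid E] [IsDirectedOrder E] {T : Lr E F} :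
    0 ≤ T ↔ IsPositiveOp (toLin T) := by
  rw [le_def, map_zero, sub_zero]

instance [IsOrderedAddMonoid E] [IsDirectedOrder E] : IsOrderedAddMonoid (Lr E F) where
  add_le_add_left S T h U := by
    rw [le_def, map_add, map_add, add_sub_add_right_eq_sub]
    exact h

instance [IsOrderedAddMonoid E] [IsDirectedOrder E] : IsOrderedModule ℝ (Lr E F) where
  smul_le_smul_of_nonneg_left c hc S T h := by
    rw [le_def, map_smul, map_smul, ← smul_sub]
    exact IsPositiveOp.smul hc h
  smul_le_smul_of_nonneg_right T hT c d h := by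
    rw [le_def, map_smul, map_smul, ← sub_smul]
    exact IsPositiveOp.smul (sub_nonneg.mpr h) (nonneg_iff.mp hT)

instance [IsOrderedAddMonoid E] [IsDirectedOrder E] : IsDirectedOrder (Lr E F) where
  directed S T := by
    obtain ⟨P, Q, hP, hQ, hS⟩ := exists_pos_sub_pos S
    obtain ⟨P', Q', hP', hQ', hT⟩ := exists_pos_sub_pos T
    refine ⟨mk (P + P') ⟨P + P', 0, hP.add hP', IsPositiveOp.zero, (sub_zero _).symm⟩, ?_, ?_⟩
    · rw [le_def, toLin_mk, hS, show P + P' - (P - Q) = P' + Q by abel]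
      exact hP'.add hQ
    · rw [le_def, toLin_mk, hT, show P + P' - (P' - Q') = P + Q' by abel]
      exact hP.add hQ'

end

/-- `S` is the modulus `|T|` of `T`: the supremum of `T` and `-T` in the ordered vector space of
regular operators. -/
def IsModulus {E F : Type*} [AddCommGroup E] [PartialOrder E] [IsOrderedAddMonoid E]
    [IsDirectedOrder E] [Module ℝ E]
    [AddCommGroup F] [PartialOrder F] [IsOrderedAddMonoid F] [Module ℝ F] [IsOrderedModule ℝ F]
    (S T : Lr E F) : Prop :=
  IsLUB {T, -T} S

section Comp

variable {E F G : Type*} [AddCommGroup E] [PartialOrder E] [Module ℝ E]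
  [AddCommGroup F] [PartialOrder F] [IsOrderedAddMonoid F] [Module ℝ F] [IsOrderedModule ℝ F]
  [AddCommGroup G] [PartialOrder G] [IsOrderedAddMonoid G] [Module ℝ G] [IsOrderedModule ℝ G]

/-- The composition of two regular operators. -/
def comp (A : Lr F G) (B : Lr E F) : Lr E G :=
  mk (toLin A ∘ₗ toLin B) (by
    obtain ⟨P, Q, hP, hQ, hA⟩ := exists_pos_sub_pos A
    obtain ⟨P', Q', hP', hQ', hB⟩ := exists_pos_sub_pos B
    refine ⟨P ∘ₗ P' + Q ∘ₗ Q', P ∘ₗ Q' + Q ∘ₗ P', (hP.comp hP').add (hQ.comp hQ'),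
      (hP.comp hQ').add (hQ.comp hP'), ?_⟩
    rw [hA, hB, LinearMap.sub_comp, LinearMap.comp_sub, LinearMap.comp_sub]
    abel)

@[simp] theorem toLin_comp (A : Lr F G) (B : Lr E F) :
    toLin (comp A B) = toLin A ∘ₗ toLin B := rfl

end Comp

section Mul

variable {W X Y Z : Type*}
  [AddCommGroup W] [PartialOrder W] [IsOrderedAddMonoid W] [IsDirectedOrder W] [Module ℝ W]
  [AddCommGroup X] [PartialOrder X] [IsOrderedAddMonoid X] [IsDirectedOrder X] [Module ℝ X]
  [IsOrderedModule ℝ X]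
  [AddCommGroup Y] [PartialOrder Y] [IsOrderedAddMonoid Y] [Module ℝ Y] [IsOrderedModule ℝ Y]
  [AddCommGroup Z] [PartialOrder Z] [IsOrderedAddMonoid Z] [Module ℝ Z] [IsOrderedModule ℝ Z]

/-- The linear map `T ↦ A T B` from `L^r(X, Y)` to `L^r(W, Z)`. -/
def mulLin (A : Lr Y Z) (B : Lr W X) : Lr X Y →ₗ[ℝ] Lr W Z where
  toFun T := comp A (comp T B)
  map_add' S T := toLin_injective <| by
    simp only [toLin_comp, map_add, LinearMap.add_comp, LinearMap.comp_add]
  map_smul' c T := toLin_injective <| by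
    simp only [toLin_comp, map_smul, LinearMap.smul_comp, LinearMap.comp_smul, RingHom.id_apply]

theorem mulLin_isPositiveOp {A : Lr Y Z} {B : Lr W X} (hA : IsPositiveOp (toLin A))
    (hB : IsPositiveOp (toLin B)) : IsPositiveOp (mulLin A B) :=
  fun _ hT => nonneg_iff.mpr (hA.comp ((nonneg_iff.mp hT).comp hB))

theorem mulLin_regular (A : Lr Y Z) (B : Lr W X) :
    ∃ P Q : Lr X Y →ₗ[ℝ] Lr W Z, IsPositiveOp P ∧ IsPositiveOp Q ∧ mulLin A B = P - Q := by
  obtain ⟨P, Q, hP, hQ, hA⟩ := exists_pos_sub_pos A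
  obtain ⟨P', Q', hP', hQ', hB⟩ := exists_pos_sub_pos B
  let p : Lr Y Z := mk P ⟨P, 0, hP, IsPositiveOp.zero, (sub_zero _).symm⟩
  let q : Lr Y Z := mk Q ⟨Q, 0, hQ, IsPositiveOp.zero, (sub_zero _).symm⟩
  let p' : Lr W X := mk P' ⟨P', 0, hP', IsPositiveOp.zero, (sub_zero _).symm⟩
  let q' : Lr W X := mk Q' ⟨Q', 0, hQ', IsPositiveOp.zero, (sub_zero _).symm⟩
  refine ⟨mulLin p p' + mulLin q q', mulLin p q' + mulLin q p',
    (mulLin_isPositiveOp (A := p) (B := p') hP hP').add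
      (mulLin_isPositiveOp (A := q) (B := q') hQ hQ'),
    (mulLin_isPositiveOp (A := p) (B := q') hP hQ').add
      (mulLin_isPositiveOp (A := q) (B := p') hQ hP'), ?_⟩
  refine LinearMap.ext fun T => toLin_injective (LinearMap.ext fun w => ?_)
  change toLin A (toLin T (toLin B w)) =
    P (toLin T (P' w)) + Q (toLin T (Q' w)) - (P (toLin T (Q' w)) + Q (toLin T (P' w)))
  rw [hA, hB]
  simp only [LinearMap.sub_apply, map_sub]
  abel

/-- The two-sided multiplication operator `M_{A,B} : T ↦ A T B`, as a regular operator from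
`L^r(X, Y)` to `L^r(W, Z)`. -/
def mulOp (A : Lr Y Z) (B : Lr W X) : Lr (Lr X Y) (Lr W Z) :=
  mk (mulLin A B) (mulLin_regular A B)

theorem mulOp_apply (A : Lr Y Z) (B : Lr W X) (T : Lr X Y) (w : W) :
    toLin (toLin (mulOp A B) T) w = toLin A (toLin T (toLin B w)) := rfl

end Mul

end Lr

/-! That `mulOp absA absB` bounds $\pm M_{A,B}$ is elementary (`mulOp_mem_upperBounds`). For
leastness let $U \ge \pm M_{A,B}$, $T \ge 0$, $w \ge 0$. If $|S| \le T$, then $T+S$ and $T-S$ are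
positive, and adding the bounds of $U$ on them gives $ASBw \le U(T)w$.

By Hahn–Banach–Kantorovich the vectors $SBw$ with $|S| \le T$ are exactly the $u$ with $|u| \le
T|Bw|$ (`exists_dominated_apply_eq`), so Riesz–Kantorovich for $A$ gives $|A|\,T|Bw| \le U(T)w$.
Summing over a partition $w = \sum w_i$ bounds $|A|\,T\sum|Bw_i|$ by $U(T)w$. These sums are
directed upwards with supremum $|B|w$. Order continuity of the norm of $X$ approximates $|B|w$ by
them in norm, and the positive operator $|A|T$ carries the bound to $|B|w$ (`map_le_of_approx`).

Order continuity also makes $X$ and $Y$ Dedekind complete, as needed for $|B|$ to exist and for the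
extension of operators into $Y$. -/

/-- Every nonempty subset that is bounded above has a least upper bound. -/
def DedekindComplete (E : Type*) [PartialOrder E] : Prop :=
  ∀ s : Set E, s.Nonempty → BddAbove s → ∃ a, IsLUB s a

theorem dedekindComplete_of_conditionallyCompleteLattice (E : Type*)
    [ConditionallyCompleteLattice E] : DedekindComplete E :=
  fun s hs hb => ⟨sSup s, isLUB_csSup hs hb⟩

/-! ### Order continuous norms and Dedekind completeness. -/

section OrderContinuous

variable {E : Type*} [NormedAddCommGroup E] [Lattice E] [IsOrderedAddMonoid E]

theorem OrderContinuousNorm.exists_norm_lt {E : Type*} [NormedAddCommGroup E] [Lattice E]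
    (hE : OrderContinuousNorm E) {D : Set E}
    (hne : D.Nonempty) (hdir : DirectedOn (fun x y => y ≤ x) D) (hD : IsGLB D 0)
    {ε : ℝ} (hε : 0 < ε) : ∃ x ∈ D, ‖x‖ < ε := by
  by_contra! h
  refine absurd ((hE D hne hdir hD).2 (?_ : ε ∈ _)) (not_le.mpr hε)
  rintro _ ⟨x, hx, rfl⟩
  exact h x hx

theorem OrderContinuousNorm.exists_norm_sub_lt (hE : OrderContinuousNorm E) {D : Set E}
    (hne : D.Nonempty) (hdir : DirectedOn (· ≤ ·) D) {s : E} (hs : IsLUB D s)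
    {ε : ℝ} (hε : 0 < ε) : ∃ x ∈ D, ‖s - x‖ < ε := by
  have hdir' : DirectedOn (fun x y => y ≤ x) ((fun x => s - x) '' D) := by
    rintro _ ⟨x, hx, rfl⟩ _ ⟨y, hy, rfl⟩
    obtain ⟨z, hz, hxz, hyz⟩ := hdir x hx y hy
    exact ⟨_, ⟨z, hz, rfl⟩, sub_le_sub_left hxz s, sub_le_sub_left hyz s⟩
  have hglb : IsGLB ((fun x => s - x) '' D) 0 := by
    refine ⟨?_, fun c hc => ?_⟩
    · rintro _ ⟨x, hx, rfl⟩
      exact sub_nonneg.mpr (hs.1 hx)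
    · have : s ≤ s - c := hs.2 fun x hx => le_sub_comm.mp (hc ⟨x, hx, rfl⟩)
      simpa using this
  obtain ⟨_, ⟨x, hx, rfl⟩, h⟩ := hE.exists_norm_lt (hne.image _) hdir' hglb hε
  exact ⟨x, hx, h⟩

variable [HasSolidNorm E] [NormedSpace ℝ E] [IsOrderedModule ℝ E]

theorem nonpos_of_forall_nsmul_le {z c : E} (h : ∀ n : ℕ, n • z ≤ c) : z ≤ 0 := by
  have hlim : Filter.Tendsto (fun n : ℕ => ((n : ℝ) + 1)⁻¹ • c) Filter.atTop (nhds 0) := by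
    have := (tendsto_one_div_add_atTop_nhds_zero_nat (𝕜 := ℝ)).smul_const c
    simpa using this
  refine ge_of_tendsto' hlim fun n => ?_
  have hn : (0 : ℝ) < (n : ℝ) + 1 := by positivity
  have h1 : ((n : ℝ) + 1) • z ≤ c := by
    have := h (n + 1)
    rwa [← Nat.cast_smul_eq_nsmul ℝ, Nat.cast_add, Nat.cast_one] at this
  calc z = ((n : ℝ) + 1)⁻¹ • (((n : ℝ) + 1) • z) := by rw [inv_smul_smul₀ hn.ne']
    _ ≤ _ := smul_le_smul_of_nonneg_left h1 (by positivity)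

/-- The gaps $b - d$ between upper bounds and elements of $D$ form a downwards directed set with
infimum 0, so some gaps have arbitrarily small norm. They squeeze a Cauchy sequence in $D$ and a
sequence of upper bounds to one limit, which is the supremum because the order is closed. -/
theorem exists_isLUB_of_directedOn [CompleteSpace E] (hE : OrderContinuousNorm E) {D : Set E}
    (hne : D.Nonempty) (hdir : DirectedOn (· ≤ ·) D) (hb : BddAbove D) : ∃ s, IsLUB D s := by
  have hsmall : ∀ ε : ℝ, 0 < ε → ∃ b ∈ upperBounds D, ∃ d ∈ D, ‖b - d‖ < ε := by
    intro ε hε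
    have hdir' : DirectedOn (fun x y => y ≤ x)
        (Set.image2 (fun b d => b - d) (upperBounds D) D) := by
      rintro _ ⟨b, hb, d, hd, rfl⟩ _ ⟨b', hb', d', hd', rfl⟩
      obtain ⟨e, he, h1, h2⟩ := hdir d hd d' hd'
      exact ⟨_, ⟨b ⊓ b', fun x hx => le_inf (hb hx) (hb' hx), e, he, rfl⟩,
        sub_le_sub inf_le_left h1, sub_le_sub inf_le_right h2⟩
    have hglb : IsGLB (Set.image2 (fun b d => b - d) (upperBounds D) D) 0 := by
      refine ⟨?_, fun z hz => ?_⟩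
      · rintro _ ⟨b, hb, d, hd, rfl⟩
        exact sub_nonneg.mpr (hb hd)
      · obtain ⟨b, hb⟩ := hb
        obtain ⟨d, hd⟩ := hne
        -- A lower bound $z$ of the gaps can be subtracted from any upper bound of $D$, hence
        -- repeatedly; the Archimedean property then forces $z \le 0$.
        have key : ∀ n : ℕ, b - n • z ∈ upperBounds D := by
          intro n
          induction n with
          | zero => simpa using hb
          | succ n ih =>
            intro x hx
            have := hz ⟨_, ih, x, hx, rfl⟩
            rw [succ_nsmul, ← sub_sub]
            exact le_sub_comm.mp this
        exact nonpos_of_forall_nsmul_le fun n => le_sub_comm.mp (key n hd)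
    obtain ⟨_, ⟨b, hb, d, hd, rfl⟩, h⟩ :=
      hE.exists_norm_lt (Set.Nonempty.image2 hb hne) hdir' hglb hε
    exact ⟨b, hb, d, hd, h⟩
  choose b hb d hd hbd using fun n : ℕ => hsmall ((1 / 2) ^ n) (by positivity)
  have hbd0 : Filter.Tendsto (fun n => b n - d n) Filter.atTop (nhds 0) :=
    squeeze_zero_norm (fun n => (hbd n).le)
      (tendsto_pow_atTop_nhds_zero_of_lt_one (by norm_num) (by norm_num))
  have hdiff : ∀ m n, ‖d m - d n‖ ≤ ‖b m - d m‖ + ‖b n - d n‖ := by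
    intro m n
    have hm : 0 ≤ b m - d m := sub_nonneg.mpr (hb m (hd m))
    have hn : 0 ≤ b n - d n := sub_nonneg.mpr (hb n (hd n))
    refine le_trans (norm_le_norm_of_abs_le_abs (b := (b m - d m) + (b n - d n)) ?_)
      (norm_add_le _ _)
    rw [abs_of_nonneg (add_nonneg hm hn)]
    refine abs_le'.mpr ⟨?_, ?_⟩
    · exact (sub_le_sub_right (hb n (hd m)) _).trans (le_add_of_nonneg_left hm)
    · rw [neg_sub]
      exact (sub_le_sub_right (hb m (hd n)) _).trans (le_add_of_nonneg_right hn)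
  have hcauchy : CauchySeq d := by
    rw [Metric.cauchySeq_iff']
    intro ε hε
    obtain ⟨N, hN⟩ := exists_pow_lt_of_lt_one (half_pos hε) (by norm_num : (1 / 2 : ℝ) < 1)
    refine ⟨N, fun n hn => ?_⟩
    rw [dist_eq_norm]
    have h1 : ((1 : ℝ) / 2) ^ n ≤ (1 / 2) ^ N :=
      pow_le_pow_of_le_one (by norm_num) (by norm_num) hn
    linarith [hdiff n N, hbd n, hbd N]
  obtain ⟨s, hs⟩ := cauchySeq_tendsto_of_complete hcauchy
  have hbs : Filter.Tendsto b Filter.atTop (nhds s) := by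
    simpa using hs.add hbd0
  exact ⟨s, fun x hx => ge_of_tendsto' hbs fun n => hb n hx,
    fun c hc => le_of_tendsto' hs fun n => hc (hd n)⟩

theorem OrderContinuousNorm.dedekindComplete [CompleteSpace E] (hE : OrderContinuousNorm E) :
    DedekindComplete E := by
  intro s hne hb
  obtain ⟨a, ha⟩ := exists_isLUB_of_directedOn hE (D := supClosure s) (hne.mono subset_supClosure)
    supClosed_supClosure.directedOn (by rwa [BddAbove, upperBounds_supClosure])
  exact ⟨a, isLUB_supClosure.mp ha⟩

end OrderContinuous

/-! ### Automatic continuity of positive operators. -/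

section NormLimit

variable {E F : Type*} [NormedAddCommGroup E] [Lattice E] [IsOrderedAddMonoid E] [HasSolidNorm E]
  [NormedSpace ℝ E] [IsOrderedModule ℝ E] [CompleteSpace E]
  [NormedAddCommGroup F] [Lattice F] [IsOrderedAddMonoid F] [HasSolidNorm F]
  [NormedSpace ℝ F] [IsOrderedModule ℝ F]

/-- A bound for a positive operator on a Banach lattice passes to norm limits from below. -/
theorem IsPositiveOp.map_le_of_approx {R : E →ₗ[ℝ] F} (hR : IsPositiveOp R) {D : Set E} {s : E}
    (hs : s ∈ upperBounds D) (happrox : ∀ ε : ℝ, 0 < ε → ∃ x ∈ D, ‖s - x‖ < ε) {v : F}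
    (hv : ∀ x ∈ D, R x ≤ v) : R s ≤ v := by
  -- The rate $4^{-n}$ leaves room for weights $2^n$: the series $x = \sum 2^n(s - a_n)$ converges
  -- and dominates each term, so $R(s - a_n) \le 2^{-n} R x$.
  choose a ha has using fun n : ℕ => happrox ((1 / 4) ^ n) (by positivity)
  have hnn : ∀ n, 0 ≤ (2 : ℝ) ^ n • (s - a n) := fun n =>
    smul_nonneg (by positivity) (sub_nonneg.mpr (hs (ha n)))
  have hsum : Summable fun n => (2 : ℝ) ^ n • (s - a n) := by
    refine Summable.of_norm_bounded (g := fun n => (1 / 2 : ℝ) ^ n)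
      (summable_geometric_of_lt_one (by norm_num) (by norm_num)) fun n => ?_
    rw [norm_smul, norm_pow, Real.norm_ofNat]
    calc (2 : ℝ) ^ n * ‖s - a n‖ ≤ 2 ^ n * (1 / 4) ^ n :=
          mul_le_mul_of_nonneg_left (has n).le (by positivity)
      _ = (1 / 2) ^ n := by rw [← mul_pow]; norm_num
  set x := ∑' n, (2 : ℝ) ^ n • (s - a n)
  have hle : ∀ n, (2 : ℝ) ^ n • (s - a n) ≤ x := fun n =>
    hsum.le_tsum n fun m _ => hnn m
  have hlim : Filter.Tendsto (fun n : ℕ => v + (1 / 2 : ℝ) ^ n • R x) Filter.atTop (nhds v) := by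
    have := ((tendsto_pow_atTop_nhds_zero_of_lt_one (r := (1 / 2 : ℝ)) (by norm_num)
      (by norm_num)).smul_const (R x)).const_add v
    simpa using this
  refine ge_of_tendsto' hlim fun n => ?_
  have h1 : (2 : ℝ) ^ n • R (s - a n) ≤ R x := by
    rw [← map_smul, ← sub_nonneg, ← map_sub]
    exact hR _ (sub_nonneg.mpr (hle n))
  have h2 : R (s - a n) ≤ (1 / 2 : ℝ) ^ n • R x := by
    calc R (s - a n) = (1 / 2 : ℝ) ^ n • ((2 : ℝ) ^ n • R (s - a n)) := by
          rw [smul_smul, ← mul_pow]; norm_num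
      _ ≤ _ := smul_le_smul_of_nonneg_left h1 (by positivity)
  calc R s = R (a n) + R (s - a n) := by rw [← map_add]; congr 1; abel
    _ ≤ _ := add_le_add (hv _ (ha n)) h2

end NormLimit

/-! ### Partition sums and the Riesz–Kantorovich formula. -/

section RieszKantorovich

variable {E F : Type*} [AddCommGroup E] [Lattice E] [Module ℝ E]
  [AddCommGroup F] [Lattice F] [Module ℝ F]

/-- `PartitionSum T x a` holds if `a` is a sum `∑ |T xᵢ|` over a finite partition `x = ∑ xᵢ` of
`x` into positive vectors. -/
inductive PartitionSum (T : E →ₗ[ℝ] F) : E → F → Prop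
  | single (x : E) (hx : 0 ≤ x) : PartitionSum T x |T x|
  | add {x y : E} {a b : F} (ha : PartitionSum T x a) (hb : PartitionSum T y b) :
      PartitionSum T (x + y) (a + b)

theorem abs_smul_of_pos [IsOrderedModule ℝ E] {c : ℝ} (hc : 0 < c) (x : E) : |c • x| = c • |x| := by
  have h : ∀ (c : ℝ) (x : E), 0 < c → |c • x| ≤ c • |x| := fun c x hc =>
    abs_le'.mpr ⟨smul_le_smul_of_nonneg_left (le_abs_self x) hc.le, by
      rw [← smul_neg]
      exact smul_le_smul_of_nonneg_left (neg_le_abs x) hc.le⟩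
  refine le_antisymm (h c x hc) ?_
  have := h c⁻¹ (c • x) (inv_pos.mpr hc)
  rwa [inv_smul_smul₀ hc.ne', le_inv_smul_iff_of_pos hc] at this

theorem IsPositiveOp.abs_le [IsOrderedAddMonoid F] {S T : E →ₗ[ℝ] F} (h1 : IsPositiveOp (S - T))
    (h2 : IsPositiveOp (S + T))
    {x : E} (hx : 0 ≤ x) : |T x| ≤ S x :=
  abs_le'.mpr ⟨sub_nonneg.mp (h1 x hx), neg_le_iff_add_nonneg.mpr (h2 x hx)⟩

theorem exists_riesz_refinement {E : Type*} [AddCommGroup E] [Lattice E] [IsOrderedAddMonoid E]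
    {u v x y : E} (hu : 0 ≤ u) (hv : 0 ≤ v) (hx : 0 ≤ x) (hy : 0 ≤ y) (h : u + v = x + y) :
    ∃ u₁ u₂ v₁ v₂ : E, 0 ≤ u₁ ∧ 0 ≤ u₂ ∧ 0 ≤ v₁ ∧ 0 ≤ v₂ ∧
      u = u₁ + u₂ ∧ v = v₁ + v₂ ∧ x = u₁ + v₁ ∧ y = u₂ + v₂ := by
  -- Choosing $u_1 = u \wedge x$ determines the other pieces; only $v_2 \ge 0$ uses the equality of
  -- the two sums.
  refine ⟨u ⊓ x, u - u ⊓ x, x - u ⊓ x, v - (x - u ⊓ x), le_inf hu hx,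
    sub_nonneg.mpr inf_le_left, sub_nonneg.mpr inf_le_right, ?_, by abel, by abel, by abel, ?_⟩
  · have h1 : x - v ≤ u ⊓ x := by
      refine le_inf ?_ (sub_le_self _ hv)
      rw [sub_le_iff_le_add, h]
      exact le_add_of_nonneg_right hy
    rw [sub_nonneg, sub_le_comm]
    exact h1
  · have : y = u + v - x := by rw [h]; abel
    rw [this]; abel

namespace PartitionSum

variable {T : E →ₗ[ℝ] F}

theorem dom_nonneg [IsOrderedAddMonoid E] {x : E} {a : F} (h : PartitionSum T x a) : 0 ≤ x := by
  induction h with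
  | single x hx => exact hx
  | add _ _ ihx ihy => exact add_nonneg ihx ihy

theorem abs_le [IsOrderedAddMonoid F] {x : E} {a : F} (h : PartitionSum T x a) : |T x| ≤ a := by
  induction h with
  | single x hx => exact le_rfl
  | add _ _ ihx ihy =>
    rw [map_add]
    exact (abs_add_le _ _).trans (add_le_add ihx ihy)

theorem le_of_abs_le [IsOrderedAddMonoid F] {S : E →ₗ[ℝ] F}
    (hS : ∀ x, 0 ≤ x → |T x| ≤ S x) {x : E} {a : F}
    (h : PartitionSum T x a) : a ≤ S x := by
  induction h with
  | single x hx => exact hS x hx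
  | add _ _ ihx ihy =>
    rw [map_add]
    exact add_le_add ihx ihy

theorem smul [IsOrderedModule ℝ E] [IsOrderedModule ℝ F] {c : ℝ} (hc : 0 < c) {x : E} {a : F}
    (h : PartitionSum T x a) : PartitionSum T (c • x) (c • a) := by
  induction h with
  | single x hx =>
    have := single (T := T) (c • x) (smul_nonneg hc.le hx)
    rwa [map_smul, abs_smul_of_pos hc] at this
  | add _ _ ihx ihy =>
    rw [smul_add, smul_add]
    exact ihx.add ihy

theorem nonempty (T : E →ₗ[ℝ] F) {x : E} (hx : 0 ≤ x) : {a | PartitionSum T x a}.Nonempty :=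
  ⟨_, single x hx⟩

variable [IsOrderedAddMonoid E] [IsOrderedAddMonoid F]

/-- Riesz decomposition cuts every piece of the partition along $x = y + z$, and by the triangle
inequality cutting can only enlarge the sum. -/
theorem exists_split {x : E} {a : F} (h : PartitionSum T x a) :
    ∀ y z : E, 0 ≤ y → 0 ≤ z → x = y + z →
      ∃ b c : F, PartitionSum T y b ∧ PartitionSum T z c ∧ a ≤ b + c := by
  induction h with
  | single x hx =>
    rintro y z hy hz rfl
    exact ⟨_, _, single y hy, single z hz, by rw [map_add]; exact abs_add_le _ _⟩
  | add hu hv ihu ihv =>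
    intro y z hy hz hyz
    obtain ⟨u₁, u₂, v₁, v₂, hu₁, hu₂, hv₁, hv₂, hu', hv', rfl, rfl⟩ :=
      exists_riesz_refinement hu.dom_nonneg hv.dom_nonneg hy hz hyz
    obtain ⟨b, c, hb, hc, h1⟩ := ihu u₁ u₂ hu₁ hu₂ hu'
    obtain ⟨b', c', hb', hc', h2⟩ := ihv v₁ v₂ hv₁ hv₂ hv'
    refine ⟨b + b', c + c', hb.add hb', hc.add hc', (add_le_add h1 h2).trans_eq ?_⟩
    abel

/-- Two partitions have a common refinement: the second is split along the pieces of the first, and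
on a single piece $|Tx|$ lies below every partition sum. -/
theorem exists_ge {x : E} {a : F} (ha : PartitionSum T x a) :
    ∀ b : F, PartitionSum T x b → ∃ c, PartitionSum T x c ∧ a ≤ c ∧ b ≤ c := by
  induction ha with
  | single x hx => exact fun b hb => ⟨b, hb, hb.abs_le, le_rfl⟩
  | add hx hy ihx ihy =>
    intro b hb
    obtain ⟨b₁, b₂, hb₁, hb₂, hle⟩ := hb.exists_split _ _ hx.dom_nonneg hy.dom_nonneg rfl
    obtain ⟨c₁, hc₁, h1, h1'⟩ := ihx b₁ hb₁
    obtain ⟨c₂, hc₂, h2, h2'⟩ := ihy b₂ hb₂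
    exact ⟨_, hc₁.add hc₂, add_le_add h1 h2, hle.trans (add_le_add h1' h2')⟩

theorem directedOn (T : E →ₗ[ℝ] F) (x : E) : DirectedOn (· ≤ ·) {a | PartitionSum T x a} :=
  fun _ ha b hb => ha.exists_ge b hb

/-- The free terms $h$ and $g$ let the induction treat one summand while the contribution of the
other is absorbed into $h$. On a single piece $u = \pm x$ suffices. -/
theorem add_le_of_forall {x : E} {a : F} (ha : PartitionSum T x a) :
    ∀ h g : F, (∀ u, |u| ≤ x → T u + h ≤ g) → a + h ≤ g := by
  induction ha with
  | single x hx =>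
    intro h g H
    rw [← le_sub_iff_add_le]
    refine abs_le'.mpr ⟨?_, ?_⟩
    · exact le_sub_iff_add_le.mpr (H x (abs_of_nonneg hx).le)
    · rw [← map_neg]
      exact le_sub_iff_add_le.mpr (H (-x) (by rw [abs_neg, abs_of_nonneg hx]))
  | @add x y a b hx hy ihx ihy =>
    intro h g H
    rw [add_assoc]
    refine ihx _ _ fun u hu => ?_
    rw [add_left_comm]
    refine ihy _ _ fun v hv => ?_
    rw [← add_assoc, ← map_add, add_comm v]
    exact H _ ((abs_add_le u v).trans (add_le_add hu hv))

/-- A common upper bound of `T u`, `|u| ≤ x`, bounds all partition sums of `T` over `x`. -/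
theorem le_of_forall {x : E} {a : F} (ha : PartitionSum T x a) {g : F}
    (H : ∀ u, |u| ≤ x → T u ≤ g) : a ≤ g := by
  simpa using ha.add_le_of_forall 0 g (by simpa using H)

end PartitionSum

/-- An additive and positively homogeneous map on the positive cone extends to a linear map. -/
theorem exists_linearMap_of_cone {E F : Type*} [AddCommGroup E] [Lattice E] [IsOrderedAddMonoid E]
    [Module ℝ E] [IsOrderedModule ℝ E] [AddCommGroup F] [Module ℝ F] (f : E → F)
    (hadd : ∀ x y, 0 ≤ x → 0 ≤ y → f (x + y) = f x + f y)
    (hsmul : ∀ (c : ℝ) x, 0 < c → 0 ≤ x → f (c • x) = c • f x) :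
    ∃ L : E →ₗ[ℝ] F, ∀ x, 0 ≤ x → L x = f x := by
  have h0 : f 0 = 0 := by simpa using hadd 0 0 le_rfl le_rfl
  -- The value does not depend on how a vector is written as a difference of positive ones, so
  -- linearity can be checked on a convenient decomposition.
  have key : ∀ x y, 0 ≤ x → 0 ≤ y → f ((x - y)⁺) - f ((x - y)⁻) = f x - f y := by
    intro x y hx hy
    have h : (x - y)⁺ + y = x + (x - y)⁻ := by
      have := posPart_sub_negPart (x - y)
      rw [sub_eq_sub_iff_add_eq_add] at this
      exact this
    have h' := congrArg f h
    rw [hadd _ _ (posPart_nonneg _) hy, hadd _ _ hx (negPart_nonneg _)] at h'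
    rw [sub_eq_sub_iff_add_eq_add, h']
  have keyn : ∀ x y, 0 ≤ x → 0 ≤ y → ∀ z, z = x - y → f (z⁺) - f (z⁻) = f x - f y := by
    rintro x y hx hy z rfl
    exact key x y hx hy
  let L : E →ₗ[ℝ] F :=
    { toFun := fun x => f (x⁺) - f (x⁻)
      map_add' := fun x y => by
        rw [keyn (x⁺ + y⁺) (x⁻ + y⁻) (add_nonneg (posPart_nonneg _) (posPart_nonneg _))
          (add_nonneg (negPart_nonneg _) (negPart_nonneg _)) (x + y) ?_,
          hadd _ _ (posPart_nonneg _) (posPart_nonneg _),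
          hadd _ _ (negPart_nonneg _) (negPart_nonneg _)]
        · abel
        · rw [add_sub_add_comm, posPart_sub_negPart, posPart_sub_negPart]
      map_smul' := fun c x => by
        have hp := posPart_nonneg x
        have hn := negPart_nonneg x
        rw [RingHom.id_apply]
        rcases lt_trichotomy c 0 with hc | rfl | hc
        · have hc' : 0 < -c := neg_pos.mpr hc
          rw [keyn ((-c) • x⁻) ((-c) • x⁺) (smul_nonneg hc'.le hn) (smul_nonneg hc'.le hp) (c • x)
            ?_, hsmul _ _ hc' hn, hsmul _ _ hc' hp]
          · module
          · nth_rewrite 1 [← posPart_sub_negPart x]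
            module
        · simp [h0]
        · rw [keyn (c • x⁺) (c • x⁻) (smul_nonneg hc.le hp) (smul_nonneg hc.le hn) (c • x)
            ?_, hsmul _ _ hc hn, hsmul _ _ hc hp, smul_sub]
          rw [← smul_sub, posPart_sub_negPart] }
  refine ⟨L, fun x hx => ?_⟩
  change f (x⁺) - f (x⁻) = f x
  rw [posPart_of_nonneg hx, negPart_of_nonneg hx, h0, sub_zero]

variable [IsOrderedAddMonoid E] [IsOrderedAddMonoid F] [IsOrderedModule ℝ F]

theorem Lr.abs_le_of_le {S T : Lr E F} (h1 : T ≤ S) (h2 : -T ≤ S) {x : E} (hx : 0 ≤ x) :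
    |Lr.toLin T x| ≤ Lr.toLin S x :=
  IsPositiveOp.abs_le h1 (by rw [Lr.le_def, map_neg, sub_neg_eq_add] at h2; exact h2) hx

variable [IsOrderedModule ℝ E]

/-- The Riesz–Kantorovich formula for the modulus of a regular operator. -/
theorem Lr.exists_isModulus (hF : DedekindComplete F) (T : Lr E F) :
    ∃ S : Lr E F, Lr.IsModulus S T ∧
      ∀ x, 0 ≤ x → IsLUB {a | PartitionSum (Lr.toLin T) x a} (Lr.toLin S x) := by
  obtain ⟨P, Q, hP, hQ, hPQ⟩ := Lr.exists_pos_sub_pos T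
  have hdom : ∀ x, 0 ≤ x → |Lr.toLin T x| ≤ (P + Q) x := fun x hx => by
    refine IsPositiveOp.abs_le ?_ ?_ hx
    · rw [hPQ, show P + Q - (P - Q) = Q + Q by abel]
      exact hQ.add hQ
    · rw [hPQ, show P + Q + (P - Q) = P + P by abel]
      exact hP.add hP
  have hex : ∀ x, ∃ s, 0 ≤ x → IsLUB {a | PartitionSum (Lr.toLin T) x a} s := fun x => by
    by_cases hx : 0 ≤ x
    · obtain ⟨s, hs⟩ := hF {a | PartitionSum (Lr.toLin T) x a} (PartitionSum.nonempty _ hx)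
        ⟨(P + Q) x, fun a ha => PartitionSum.le_of_abs_le hdom ha⟩
      exact ⟨s, fun _ => hs⟩
    -- A junk value: only the restriction of `f` to the positive cone is used.
    · exact ⟨0, fun h => absurd h hx⟩
  choose f hf using hex
  obtain ⟨L, hL⟩ := exists_linearMap_of_cone f
    (fun x y hx hy => by
      -- Splitting partitions gives subadditivity, concatenating them gives superadditivity.
      refine le_antisymm ((hf _ (add_nonneg hx hy)).2 fun a ha => ?_) ?_
      · obtain ⟨b, c, hb, hc, h⟩ := ha.exists_split x y hx hy rfl
        exact h.trans (add_le_add ((hf x hx).1 hb) ((hf y hy).1 hc))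
      · rw [← le_sub_iff_add_le]
        refine (hf x hx).2 fun a ha => ?_
        rw [le_sub_comm]
        refine (hf y hy).2 fun b hb => ?_
        rw [le_sub_iff_add_le, add_comm]
        exact (hf _ (add_nonneg hx hy)).1 (ha.add hb))
    (fun c x hc hx => by
      have hle : ∀ (c : ℝ) x, 0 < c → 0 ≤ x → c • f x ≤ f (c • x) := by
        intro c x hc hx
        rw [← le_inv_smul_iff_of_pos hc]
        refine (hf x hx).2 fun a ha => ?_
        rw [le_inv_smul_iff_of_pos hc]
        exact (hf _ (smul_nonneg hc.le hx)).1 (ha.smul hc)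
      refine le_antisymm ?_ (hle c x hc hx)
      have := hle c⁻¹ (c • x) (inv_pos.mpr hc) (smul_nonneg hc.le hx)
      rwa [inv_smul_smul₀ hc.ne', inv_smul_le_iff_of_pos hc] at this)
  have habs : ∀ x, 0 ≤ x → |Lr.toLin T x| ≤ L x := fun x hx => by
    rw [hL x hx]
    exact (hf x hx).1 (PartitionSum.single x hx)
  have hLpos : IsPositiveOp L := fun x hx => (abs_nonneg _).trans (habs x hx)
  refine ⟨Lr.mk L ⟨L, 0, hLpos, IsPositiveOp.zero, (sub_zero _).symm⟩, ⟨?_, ?_⟩, fun x hx => ?_⟩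
  · rintro _ (rfl | rfl)
    · exact fun x hx => sub_nonneg.mpr ((le_abs_self _).trans (habs x hx))
    · intro x hx
      rw [map_neg, LinearMap.sub_apply, LinearMap.neg_apply]
      exact sub_nonneg.mpr ((neg_le_abs _).trans (habs x hx))
  · intro U hU x hx
    rw [LinearMap.sub_apply, sub_nonneg, Lr.toLin_mk, hL x hx]
    refine (hf x hx).2 fun a ha => ha.le_of_abs_le fun y hy => ?_
    exact Lr.abs_le_of_le (hU (Set.mem_insert _ _)) (hU (Set.mem_insert_of_mem _ rfl)) hy
  · rw [Lr.toLin_mk, hL x hx]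
    exact hf x hx

end RieszKantorovich

/-! ### Extension of dominated operators into a Dedekind complete space. -/

section HahnBanachKantorovich

variable {E F : Type*} [AddCommGroup E] [Module ℝ E] [AddCommGroup F] [PartialOrder F]
  [IsOrderedAddMonoid F] [Module ℝ F] [IsOrderedModule ℝ F]

/-- One-dimensional extension of a partial linear map dominated by a sublinear map. -/
theorem LinearPMap.exists_lt_of_le_sublinear (hF : DedekindComplete F) {p : E → F}
    (hadd : ∀ x y, p (x + y) ≤ p x + p y)
    (hsmul : ∀ (c : ℝ) x, 0 < c → p (c • x) = c • p x) (f : E →ₗ.[ℝ] F)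
    (hf : ∀ x : f.domain, f x ≤ p x) (hdom : f.domain ≠ ⊤) :
    ∃ g, f < g ∧ ∀ x : g.domain, g x ≤ p x := by
  obtain ⟨y, -, hy⟩ : ∃ y ∈ ⊤, y ∉ f.domain := SetLike.exists_of_lt (lt_top_iff_ne_top.2 hdom)
  -- A value $c$ at $y$ is admissible when it lies between all left sides and all right sides;
  -- completeness supplies the supremum of the left sides.
  have hsep : ∀ x x' : f.domain, f x - p (x - y) ≤ p (x' + y) - f x' := by
    intro x x'
    rw [sub_le_sub_iff, ← f.map_add]
    refine (hf _).trans ?_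
    have : ((x + x' : f.domain) : E) = (x' + y) + (x - y) := by
      rw [Submodule.coe_add]; abel
    rw [this]
    exact hadd _ _
  obtain ⟨c, hc⟩ := hF (Set.range fun x : f.domain => f x - p (x - y)) (Set.range_nonempty _)
    ⟨p ((0 : f.domain) + y) - f 0, by rintro _ ⟨x, rfl⟩; exact hsep x 0⟩
  have hlow : ∀ x : f.domain, f x - c ≤ p (x - y) := fun x => by
    rw [sub_le_comm]
    exact hc.1 ⟨x, rfl⟩
  have hup : ∀ x : f.domain, f x + c ≤ p (x + y) := fun x => by
    rw [← le_sub_iff_add_le']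
    exact hc.2 (by rintro _ ⟨x', rfl⟩; exact hsep x' x)
  refine ⟨f.supSpanSingleton y c hy, ?_, ?_⟩
  · refine lt_iff_le_not_ge.2 ⟨f.left_le_sup _ _, fun H => ?_⟩
    replace H := LinearPMap.domain_mono.monotone H
    rw [LinearPMap.domain_supSpanSingleton, sup_le_iff, Submodule.span_le,
      Set.singleton_subset_iff] at H
    exact hy H.2
  · rintro ⟨z, hz⟩
    rcases Submodule.mem_sup.1 hz with ⟨x, hx, y', hy', rfl⟩
    rcases Submodule.mem_span_singleton.1 hy' with ⟨r, rfl⟩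
    rw [LinearPMap.supSpanSingleton_apply_mk _ _ _ _ _ hx]
    change f ⟨x, hx⟩ + r • c ≤ p (x + r • y)
    rcases lt_trichotomy r 0 with (hr | rfl | hr)
    · have hr' : 0 < -r := neg_pos.2 hr
      have h := smul_le_smul_of_nonneg_left (hlow ((-r)⁻¹ • ⟨x, hx⟩)) hr'.le
      rw [← hsmul _ _ hr', smul_sub, smul_sub, f.map_smul, Submodule.coe_smul,
        smul_inv_smul₀ hr'.ne', smul_inv_smul₀ hr'.ne'] at h
      simpa only [neg_smul, sub_neg_eq_add] using h
    · simpa using hf ⟨x, hx⟩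
    · have h := smul_le_smul_of_nonneg_left (hup (r⁻¹ • ⟨x, hx⟩)) hr.le
      rwa [← hsmul _ _ hr, smul_add, smul_add, f.map_smul, Submodule.coe_smul,
        smul_inv_smul₀ hr.ne', smul_inv_smul₀ hr.ne'] at h

/-- The Hahn–Banach–Kantorovich theorem: a partial linear map into a Dedekind complete ordered
vector space that is dominated by a sublinear map has a dominated linear extension. -/
theorem LinearPMap.exists_extension_of_le_sublinear (hF : DedekindComplete F) {p : E → F}
    (hadd : ∀ x y, p (x + y) ≤ p x + p y)
    (hsmul : ∀ (c : ℝ) x, 0 < c → p (c • x) = c • p x) (f : E →ₗ.[ℝ] F)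
    (hf : ∀ x : f.domain, f x ≤ p x) :
    ∃ g : E →ₗ[ℝ] F, (∀ x : f.domain, g x = f x) ∧ ∀ x, g x ≤ p x := by
  set S := {q : E →ₗ.[ℝ] F | ∀ x : q.domain, q x ≤ p x}
  have hSc : ∀ c, c ⊆ S → IsChain (· ≤ ·) c → ∀ y ∈ c, ∃ ub ∈ S, ∀ z ∈ c, z ≤ ub := by
    intro c hcs c_chain y hy
    have cne : c.Nonempty := ⟨y, hy⟩
    have hcd : DirectedOn (· ≤ ·) c := c_chain.directedOn
    refine ⟨LinearPMap.sSup c hcd, ?_, fun _ ↦ LinearPMap.le_sSup hcd⟩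
    rintro ⟨x, hx⟩
    have hdir : DirectedOn (· ≤ ·) (LinearPMap.domain '' c) :=
      directedOn_image.2 (hcd.mono LinearPMap.domain_mono.monotone)
    rcases (Submodule.mem_sSup_of_directed (cne.image _) hdir).1 hx with ⟨_, ⟨q, hqc, rfl⟩, hqx⟩
    have hle : q ≤ LinearPMap.sSup c hcd := LinearPMap.le_sSup _ hqc
    rw [← hle.2 (x := ⟨x, hqx⟩) rfl]
    exact hcs hqc ⟨x, hqx⟩
  obtain ⟨q, hfq, hqS, hq⟩ := zorn_le_nonempty₀ S hSc f hf
  have htop : q.domain = ⊤ := by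
    by_contra hne
    obtain ⟨r, hqr, hr⟩ := q.exists_lt_of_le_sublinear hF hadd hsmul hqS hne
    exact hqr.not_ge (hq hr hqr.le)
  have hmem : ∀ x : E, x ∈ q.domain := fun x => htop ▸ Submodule.mem_top
  refine ⟨q.toFun ∘ₗ LinearMap.codRestrict q.domain LinearMap.id hmem, fun x => ?_,
    fun x => hqS ⟨x, hmem x⟩⟩
  exact (hfq.2 (x := x) (y := ⟨x, hmem x⟩) rfl).symm

end HahnBanachKantorovich

/-! ### Prescribing the value of a dominated operator at one vector. -/

section Interpolation

variable {E F : Type*} [AddCommGroup E] [Lattice E] [IsOrderedAddMonoid E] [Module ℝ E]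
  [IsOrderedModule ℝ E] [AddCommGroup F] [Lattice F] [IsOrderedAddMonoid F] [Module ℝ F]
  [IsOrderedModule ℝ F]

/-- For a positive operator `T`, every `u` with `|u| ≤ T |b|` is the value at `b` of an operator
whose modulus is dominated by `T`. -/
theorem IsPositiveOp.exists_dominated_apply_eq (hF : DedekindComplete F) {T : E →ₗ[ℝ] F}
    (hT : IsPositiveOp T) {b : E} {u : F} (hu : |u| ≤ T |b|) :
    ∃ S : E →ₗ[ℝ] F, IsPositiveOp (T - S) ∧ IsPositiveOp (T + S) ∧ S b = u := by
  have hmono : ∀ {x y : E}, x ≤ y → T x ≤ T y := fun {x y} h => by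
    rw [← sub_nonneg, ← map_sub]
    exact hT _ (sub_nonneg.mpr h)
  -- This makes $cb \mapsto cu$ well defined even for $b = 0$, where the bound forces $u = 0$. It is
  -- then extended under the sublinear map $x \mapsto T|x|$; testing at $\pm x$ with $x \ge 0$
  -- yields $\pm S \le T$.
  have huniq : ∀ c : ℝ, c • b = 0 → c • u = 0 := by
    intro c hc
    rcases smul_eq_zero.mp hc with rfl | rfl
    · exact zero_smul _ _
    · rw [abs_zero, map_zero] at hu
      have : u = 0 := le_antisymm ((le_abs_self u).trans hu) (neg_nonpos.mp ((neg_le_abs u).trans hu))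
      rw [this, smul_zero]
  obtain ⟨S, hS, hle⟩ := (LinearPMap.mkSpanSingleton' b u huniq).exists_extension_of_le_sublinear hF
    (p := fun x => T |x|) (fun x y => by
      rw [← map_add]
      exact hmono (abs_add_le x y))
    (fun c x hc => by rw [abs_smul_of_pos hc, map_smul]) (by
      rintro ⟨x, hx⟩
      obtain ⟨c, rfl⟩ := Submodule.mem_span_singleton.1 hx
      rw [LinearPMap.mkSpanSingleton'_apply]
      change c • u ≤ T |c • b|
      rcases lt_trichotomy c 0 with hc | rfl | hc
      · have hc' : 0 < -c := neg_pos.mpr hc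
        rw [← abs_neg, ← neg_smul, abs_smul_of_pos hc', map_smul, ← neg_smul_neg]
        exact smul_le_smul_of_nonneg_left ((neg_le_abs u).trans hu) hc'.le
      · simp
      · rw [abs_smul_of_pos hc, map_smul]
        exact smul_le_smul_of_nonneg_left ((le_abs_self u).trans hu) hc.le)
  refine ⟨S, fun x hx => ?_, fun x hx => ?_, ?_⟩
  · have := hle x
    rw [abs_of_nonneg hx] at this
    exact sub_nonneg.mpr this
  · have := hle (-x)
    rw [abs_neg, abs_of_nonneg hx, map_neg] at this
    exact neg_le_iff_add_nonneg.mp this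
  · exact (hS ⟨b, Submodule.mem_span_singleton_self b⟩).trans
      (LinearPMap.mkSpanSingleton'_apply_self (σ := RingHom.id ℝ) b u huniq _)

end Interpolation

/-! ### Upper and lower estimates for the modulus of the multiplication operator. -/

namespace Lr

theorem le_iff {E F : Type*} [AddCommGroup E] [PartialOrder E] [IsOrderedAddMonoid E]
    [IsDirectedOrder E] [Module ℝ E] [AddCommGroup F] [PartialOrder F] [IsOrderedAddMonoid F]
    [Module ℝ F] [IsOrderedModule ℝ F] {S T : Lr E F} :
    S ≤ T ↔ ∀ x, 0 ≤ x → toLin S x ≤ toLin T x :=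
  forall₂_congr fun _ _ => by rw [LinearMap.sub_apply, sub_nonneg]

section Modulus

variable {W X Y Z : Type*}
  [AddCommGroup W] [Lattice W] [IsOrderedAddMonoid W] [Module ℝ W]
  [AddCommGroup X] [Lattice X] [IsOrderedAddMonoid X] [Module ℝ X] [IsOrderedModule ℝ X]
  [AddCommGroup Y] [Lattice Y] [IsOrderedAddMonoid Y] [Module ℝ Y] [IsOrderedModule ℝ Y]
  [AddCommGroup Z] [Lattice Z] [IsOrderedAddMonoid Z] [Module ℝ Z] [IsOrderedModule ℝ Z]

theorem le_of_add_self_le_add_self {Z : Type*} [AddCommGroup Z] [Lattice Z] [Module ℝ Z]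
    [IsOrderedModule ℝ Z] {v v' : Z} (h : v + v ≤ v' + v') : v ≤ v' := by
  rw [← two_smul ℝ, ← two_smul ℝ v'] at h
  exact (smul_le_smul_iff_of_pos_left two_pos).mp h

/-- A bound of `M_{A,B}` and `-M_{A,B}` at a positive operator `T` bounds `A S B` for all `S` with
`|S| ≤ T`. -/
theorem apply_le_of_mulOp_le {A : Lr Y Z} {B : Lr W X} {U : Lr (Lr X Y) (Lr W Z)}
    (h1 : mulOp A B ≤ U) (h2 : -mulOp A B ≤ U) {T S : Lr X Y} (hS : S ≤ T) (hS' : -S ≤ T)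
    {w : W} (hw : 0 ≤ w) : toLin A (toLin S (toLin B w)) ≤ toLin (toLin U T) w := by
  -- Adding $M(T+S) \le U(T+S)$ and $-M(T-S) \le U(T-S)$ leaves $2M(S) \le 2U(T)$, where $M =
  -- M_{A,B}$.
  have hm := le_iff.mp (le_iff.mp h1 (T + S) (neg_le_iff_add_nonneg.mp hS')) w hw
  have hn := le_iff.mp (le_iff.mp h2 (T - S) (sub_nonneg.mpr hS)) w hw
  have hsum := add_le_add hm hn
  simp only [map_neg, map_sub, map_add, LinearMap.sub_apply, LinearMap.neg_apply,
    LinearMap.add_apply, mulOp_apply] at hsum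
  refine le_of_add_self_le_add_self (le_of_eq_of_le ?_ (hsum.trans_eq ?_)) <;> abel

/-- Every $u$ with $|u| \le T|Bw|$ equals $SBw$ for some $|S| \le T$, so $U(T)w$ bounds all such
$Au$, hence all partition sums of $A$ over $T|Bw|$. -/
theorem modulus_comp_le_of_mulOp_le (hY : DedekindComplete Y) {A absA : Lr Y Z} {B : Lr W X}
    (habsA : ∀ y, 0 ≤ y → IsLUB {a | PartitionSum (toLin A) y a} (toLin absA y))
    {U : Lr (Lr X Y) (Lr W Z)} (h1 : mulOp A B ≤ U) (h2 : -mulOp A B ≤ U) {T : Lr X Y}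
    (hT : 0 ≤ T) {w : W} (hw : 0 ≤ w) :
    toLin absA (toLin T |toLin B w|) ≤ toLin (toLin U T) w := by
  have hT' := nonneg_iff.mp hT
  refine (habsA _ (hT' _ (abs_nonneg _))).2 fun a ha => ha.le_of_forall fun u hu => ?_
  obtain ⟨S, hS1, hS2, rfl⟩ := hT'.exists_dominated_apply_eq hY hu
  let S' : Lr X Y := mk S ⟨toLin T + S, toLin T, hS2, hT', by abel⟩
  refine apply_le_of_mulOp_le h1 h2 (S := S') hS1 ?_ hw
  rw [le_def, map_neg, sub_neg_eq_add]
  exact hS2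

/-- Since $U(T)$ is additive in $w$, the estimates on the pieces of a partition of $w$ add up; this
replaces $|Bw|$ by the larger partition sums of $B$. -/
theorem modulus_comp_partitionSum_le (hY : DedekindComplete Y) {A absA : Lr Y Z} {B : Lr W X}
    (habsA : ∀ y, 0 ≤ y → IsLUB {a | PartitionSum (toLin A) y a} (toLin absA y))
    {U : Lr (Lr X Y) (Lr W Z)} (h1 : mulOp A B ≤ U) (h2 : -mulOp A B ≤ U) {T : Lr X Y}
    (hT : 0 ≤ T) {w : W} {a : X} (ha : PartitionSum (toLin B) w a) :
    toLin absA (toLin T a) ≤ toLin (toLin U T) w := by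
  induction ha with
  | single w hw => exact modulus_comp_le_of_mulOp_le hY habsA h1 h2 hT hw
  | add _ _ iha ihb =>
    rw [map_add, map_add, map_add]
    exact add_le_add iha ihb

/-- With $y = TBw$ and $z = T|B|w$, both $z \pm y$ are positive. Adding the estimates $|A(z \pm y)|
\le |A|(z \pm y)$ with suitable signs gives $\pm 2Ay \le 2|A|z$. -/
theorem mulOp_mem_upperBounds {A absA : Lr Y Z} {B absB : Lr W X} (hA : IsModulus absA A)
    (hB : IsModulus absB B) : mulOp absA absB ∈ upperBounds {mulOp A B, -mulOp A B} := by
  have key : ∀ (T : Lr X Y), 0 ≤ T → ∀ w : W, 0 ≤ w →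
      |toLin A (toLin T (toLin B w))| ≤ toLin absA (toLin T (toLin absB w)) := by
    intro T hT w hw
    have hA' : ∀ y, 0 ≤ y → |toLin A y| ≤ toLin absA y := fun y hy =>
      abs_le_of_le (hA.1 (Set.mem_insert _ _)) (hA.1 (Set.mem_insert_of_mem _ rfl)) hy
    have hB' : |toLin B w| ≤ toLin absB w :=
      abs_le_of_le (hB.1 (Set.mem_insert _ _)) (hB.1 (Set.mem_insert_of_mem _ rfl)) hw
    have hT' := nonneg_iff.mp hT
    have e1 := hT' _ (sub_nonneg.mpr ((le_abs_self _).trans hB'))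
    have e2 := hT' _ (neg_le_iff_add_nonneg'.mp ((neg_le_abs _).trans hB'))
    rw [map_sub] at e1
    rw [map_add] at e2
    set y := toLin T (toLin B w)
    set z := toLin T (toLin absB w)
    have f1 := hA' _ e1
    have f2 := hA' _ e2
    rw [map_sub, map_sub] at f1
    rw [map_add, map_add] at f2
    refine abs_le'.mpr ⟨le_of_add_self_le_add_self ?_, le_of_add_self_le_add_self ?_⟩
    · have g := add_le_add ((neg_le_abs _).trans f1) ((le_abs_self _).trans f2)
      convert g using 1 <;> abel
    · have g := add_le_add ((le_abs_self _).trans f1) ((neg_le_abs _).trans f2)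
      convert g using 1 <;> abel
  rintro _ (rfl | rfl)
  · exact le_iff.mpr fun T hT => le_iff.mpr fun w hw => (le_abs_self _).trans (key T hT w hw)
  · refine le_iff.mpr fun T hT => le_iff.mpr fun w hw => ?_
    simpa only [map_neg, LinearMap.neg_apply, mulOp_apply] using
      (neg_le_abs _).trans (key T hT w hw)

end Modulus

end Lr

theorem corollary2p2 {W X Y Z : Type*}
    [NormedAddCommGroup W] [Lattice W] [IsOrderedAddMonoid W] [HasSolidNorm W]
    [NormedSpace ℝ W] [IsOrderedModule ℝ W] [CompleteSpace W]
    [NormedAddCommGroup X] [Lattice X] [IsOrderedAddMonoid X] [HasSolidNorm X]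
    [NormedSpace ℝ X] [IsOrderedModule ℝ X] [CompleteSpace X]
    [NormedAddCommGroup Y] [Lattice Y] [IsOrderedAddMonoid Y] [HasSolidNorm Y]
    [NormedSpace ℝ Y] [IsOrderedModule ℝ Y] [CompleteSpace Y]
    [NormedAddCommGroup Z] [ConditionallyCompleteLattice Z] [IsOrderedAddMonoid Z] [HasSolidNorm Z]
    [NormedSpace ℝ Z] [IsOrderedModule ℝ Z] [CompleteSpace Z]
    (hX : OrderContinuousNorm X) (hY : OrderContinuousNorm Y)
    (A : Lr Y Z) (B : Lr W X) :
    ∃ (absA : Lr Y Z) (absB : Lr W X),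
      Lr.IsModulus absA A ∧ Lr.IsModulus absB B ∧
        Lr.IsModulus (Lr.mulOp absA absB) (Lr.mulOp A B) := by
  obtain ⟨absA, hA, hA'⟩ :=
    Lr.exists_isModulus (dedekindComplete_of_conditionallyCompleteLattice Z) A
  obtain ⟨absB, hB, hB'⟩ := Lr.exists_isModulus hX.dedekindComplete B
  refine ⟨absA, absB, hA, hB, Lr.mulOp_mem_upperBounds hA hB, fun U hU =>
    Lr.le_iff.mpr fun T hT => Lr.le_iff.mpr fun w hw => ?_⟩
  have hApos : IsPositiveOp (Lr.toLin absA) := fun y hy => (abs_nonneg _).trans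
    (Lr.abs_le_of_le (hA.1 (Set.mem_insert _ _)) (hA.1 (Set.mem_insert_of_mem _ rfl)) hy)
  -- The bound on partition sums of $B$ passes to their supremum $|B|w$: order continuity in $X$
  -- makes it a norm limit of them.
  exact IsPositiveOp.map_le_of_approx (R := Lr.toLin absA ∘ₗ Lr.toLin T)
      (hApos.comp (Lr.nonneg_iff.mp hT)) (hB' w hw).1
      (fun ε hε => hX.exists_norm_sub_lt (PartitionSum.nonempty _ hw)
        (PartitionSum.directedOn _ _) (hB' w hw) hε)
      fun a ha => Lr.modulus_comp_partitionSum_le hY.dedekindComplete hA'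
        (hU (Set.mem_insert _ _)) (hU (Set.mem_insert_of_mem _ rfl)) hT ha
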